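/- A directed graph $E=(E^0,E^1,r,s)$ consists of sets of vertices and edges with range and source maps. A textile system $T=(E,F,p,q)$ consists of directed graphs $E,F$ and graph morphisms $p,q:F\to E$ such that $f\mapsto (p(f),q(f),r(f),s(f))$ is injective on $F^1$. Suppose that $p$ has unique $r$-path lifting (for all $e\in E^1$, $w\in F^0$ with $r(e)=p(w)$ there is exactly one $f\in F^1$ with $r(f)=w$ and $p(f)=e$) and that $q$ has unique $s$-path lifting (the same with $s$ in place of $r$ and $q$ in place of $p$). Let $A$ be an abelian group. Let $G_T$ be the $2$-coloured graph with vertex set $E^0$, with the edges $e \in E^1$ in colour $c_1$ (with their range and source in $E$), and with the elements $w \in F^0$ as edges of colour $c_2$, $s(w)=p(w)$, $r(w)=q(w)$. Let $\mathcal C_T$ be the collection of squares $\phi_f$, $f\in F^1$, in $G_T$, where $\phi_f$ has the two sides $q(f)\,s(f)$ and $r(f)\,p(f)$. A $2$-graph $\Lambda$ is a countable category with a degree functor $d$ to $\mathbb N^2$ that has the factorisation property; $\Lambda^m=d^{-1}(m)$. Its $1$-skeleton is the $2$-coloured graph with vertices $\Lambda^0=\mathrm{Obj}(\Lambda)$ and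 with edges $\Lambda^{e_i}$ in colour $c_i$, and its canonical squares $\mathcal C_\Lambda$ are given by the two factorisations $\lambda=f_1g_1=g_2f_2$ ($f_i\in\Lambda^{e_1}$, $g_i\in\Lambda^{e_2}$) of the elements $\lambda\in\Lambda^{e_1+e_2}$. We say that $\Lambda$ is associated with $T$, and write $\Lambda=\Lambda_T$, if there is an isomorphism of coloured graphs from the $1$-skeleton of $\Lambda$ to $G_T$ that carries each square in $\mathcal C_\Lambda$ to a square in $\mathcal C_T$. For $T$ put $C^0(T,A)=\mathrm{Hom}(\mathbb ZE^0,A)$, $C^1(T,A)=\mathrm{Hom}(\mathbb ZE^1,A)\oplus \mathrm{Hom}(\mathbb ZF^0,A)$, $C^2(T,A)=\mathrm{Hom}(\mathbb ZF^1,A)$ and $C^n(T,A)=0$ for $n\ge 3$, with $$\delta^0_T b\,(e\oplus w)=b(s(e))-b(r(e))+b(p(w))-b(q(w)),$$ $$\delta^1_T(b_E\oplus b_F)(f)=b_E(q(f))-b_E(p(f))+b_F(s(f))-b_F(r(f)).$$ For a $2$-graph $\Lambda$ put $C^i(\Lambda,A)=\mathrm{Hom}(C_i(\Lambda),A)$ with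 $C_0(\Lambda)=\mathbb Z\Lambda^0$, $C_1(\Lambda)=\mathbb Z\Lambda^{e_1}\oplus\mathbb Z\Lambda^{e_2}$, $C_2(\Lambda)=\mathbb Z\Lambda^{e_1+e_2}$ and $C_n(\Lambda)=0$ for $n\ge3$, with $$\delta^0_\Lambda b(\lambda)=b(s(\lambda))-b(r(\lambda)),\qquad \delta^1_\Lambda b(\lambda)=b(f_1)+b(g_1)-b(f_2)-b(g_2)\quad\text{for }\lambda=f_1g_1=g_2f_2.$$ Let $H^n(T,A)$ and $H^n(\Lambda,A)$ be the cohomology groups of these cochain complexes. Then, provided that $E^0,E^1,F^0,F^1$ are countable, there is a $2$-graph associated with $T$. Moreover, for every $2$-graph $\Lambda=\Lambda_T$ associated with $T$, the cochain complexes $(C^*(\Lambda,A),\delta_\Lambda^*)$ and $(C^*(T,A),\delta_T^*)$ are isomorphic, and hence $H^n(\Lambda,A)\cong H^n(T,A)$ for all $n\ge 0$. -/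

import Mathlib

open CategoryTheory

universe u w

namespace Textile

/-! ### Directed graphs and graph morphisms -/

/-- A directed graph `(E⁰, E¹, r, s)`. -/
structure DirGraph where
  /-- vertices -/
  V : Type u
  /-- edges -/
  E : Type u
  /-- range map -/
  r : E → V
  /-- source map -/
  s : E → V

/-- A graph morphism `p = (p⁰, p¹) : F → E`. -/
@[ext]
structure GraphHom (F E : DirGraph.{u}) where
  onV : F.V → E.V
  onE : F.E → E.E
  r_onE : ∀ f, E.r (onE f) = onV (F.r f)
  s_onE : ∀ f, E.s (onE f) = onV (F.s f)

/-- Unique `r`-path lifting: for every edge `e` of `E` and every vertex `v` of `F` with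
`r(e) = p(v)` there is exactly one edge `f` of `F` with `r(f) = v` and `p(f) = e`. -/
def GraphHom.UniqueRLifting {F E : DirGraph.{u}} (p : GraphHom F E) : Prop :=
  ∀ (e : E.E) (v : F.V), E.r e = p.onV v → ∃! f : F.E, F.r f = v ∧ p.onE f = e

/-- Unique `s`-path lifting. -/
def GraphHom.UniqueSLifting {F E : DirGraph.{u}} (p : GraphHom F E) : Prop :=
  ∀ (e : E.E) (v : F.V), E.s e = p.onV v → ∃! f : F.E, F.s f = v ∧ p.onE f = e

/-! ### Two-coloured graphs and squares -/

/-- The two colours. -/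
inductive Colour
  | c1
  | c2

/-- A `2`-coloured graph. -/
structure ColGraph extends DirGraph.{u} where
  colour : E → Colour

/-- A coloured-graph morphism. -/
@[ext]
structure ColHom (F E : ColGraph.{u}) extends GraphHom F.toDirGraph E.toDirGraph where
  colour_onE : ∀ f, E.colour (onE f) = F.colour f

/-- Composition `ψ ∘ φ` of coloured-graph morphisms. -/
def ColHom.comp {D F E : ColGraph.{u}} (ψ : ColHom F E) (φ : ColHom D F) : ColHom D E where
  onV := ψ.onV ∘ φ.onV
  onE := ψ.onE ∘ φ.onE
  r_onE f := by simp [ψ.r_onE, φ.r_onE]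
  s_onE f := by simp [ψ.s_onE, φ.s_onE]
  colour_onE f := by simp [ψ.colour_onE, φ.colour_onE]

/-- A coloured-graph morphism is an isomorphism if it is bijective on vertices and on edges. -/
def ColHom.IsIso {F E : ColGraph.{u}} (φ : ColHom F E) : Prop :=
  Function.Bijective φ.onV ∧ Function.Bijective φ.onE

/-- The vertices `0, e₁, e₂, e₁ + e₂` of the model square `E_{2, e₁ + e₂}`. -/
inductive SqV : Type u
  | zero
  | e1
  | e2
  | e12

/-- The edges of the model square `E_{2, e₁ + e₂}`: `eps1_0` stands for `ε₁^0`, `eps1_e2` for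
`ε₁^{e₂}`, `eps2_0` for `ε₂^0` and `eps2_e1` for `ε₂^{e₁}`. -/
inductive SqE : Type u
  | eps1_0
  | eps1_e2
  | eps2_0
  | eps2_e1

/-- The model square `E_{2, e₁ + e₂}`: `r(ε_i^n) = n`, `s(ε_i^n) = n + e_i`, `c(ε_i^n) = c_i`. -/
def modelSquare : ColGraph.{u} where
  V := SqV
  E := SqE
  r
    | .eps1_0 => .zero
    | .eps1_e2 => .e2
    | .eps2_0 => .zero
    | .eps2_e1 => .e1
  s
    | .eps1_0 => .e1
    | .eps1_e2 => .e12
    | .eps2_0 => .e2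
    | .eps2_e1 => .e12
  colour
    | .eps1_0 => .c1
    | .eps1_e2 => .c1
    | .eps2_0 => .c2
    | .eps2_e1 => .c2

/-- A square in a `2`-coloured graph. -/
abbrev Square (G : ColGraph.{u}) := ColHom modelSquare.{u} G

/-- `(E, C) ≅ (F, D)`: there is a coloured-graph isomorphism `φ : E → F` with `φ ∘ ψ ∈ D` for each
`ψ ∈ C`. -/
def SquareIsomorphic (E : ColGraph.{u}) (C : Set (Square E)) (F : ColGraph.{u})
    (D : Set (Square F)) : Prop :=
  ∃ φ : ColHom E F, φ.IsIso ∧ ∀ ψ ∈ C, φ.comp ψ ∈ D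

/-! ### Textile systems -/

/-- A textile system `T = (E, F, p, q)`. -/
structure TextileSystem where
  E : DirGraph.{u}
  F : DirGraph.{u}
  p : GraphHom F E
  q : GraphHom F E
  inj : Function.Injective fun f : F.E => (p.onE f, q.onE f, F.r f, F.s f)

namespace TextileSystem

/-- All vertex and edge sets of the textile system are countable. -/
def IsCountable (T : TextileSystem.{u}) : Prop :=
  (Countable T.E.V ∧ Countable T.E.E) ∧ (Countable T.F.V ∧ Countable T.F.E)

/-- The `2`-coloured graph `G_T`: its vertices are `E⁰`, its edges of colour `c₁` are the edges of
`E`, and its edges of colour `c₂` are the vertices `v` of `F`, with source `p(v)` and range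
`q(v)`. -/
def graph (T : TextileSystem.{u}) : ColGraph.{u} where
  V := T.E.V
  E := T.E.E ⊕ T.F.V
  r := Sum.elim T.E.r T.q.onV
  s := Sum.elim T.E.s T.p.onV
  colour := Sum.elim (fun _ => .c1) (fun _ => .c2)

/-- The square `φ_f` in `G_T` given by an edge `f` of `F`. -/
def square (T : TextileSystem.{u}) (f : T.F.E) : Square T.graph where
  onV
    | .zero => T.q.onV (T.F.r f)
    | .e1 => T.q.onV (T.F.s f)
    | .e2 => T.p.onV (T.F.r f)
    | .e12 => T.p.onV (T.F.s f)
  onE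
    | .eps1_0 => Sum.inl (T.q.onE f)
    | .eps1_e2 => Sum.inl (T.p.onE f)
    | .eps2_0 => Sum.inr (T.F.r f)
    | .eps2_e1 => Sum.inr (T.F.s f)
  r_onE ε := by
    cases ε <;> simp [graph, modelSquare, T.q.r_onE, T.p.r_onE]
  s_onE ε := by
    cases ε <;> simp [graph, modelSquare, T.q.s_onE, T.p.s_onE]
  colour_onE ε := by
    cases ε <;> simp [graph, modelSquare]

/-- The collection of squares `C_T = {φ_f : f ∈ F¹}`. -/
def squares (T : TextileSystem.{u}) : Set (Square T.graph) := Set.range T.square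

end TextileSystem

/-! ### `2`-graphs -/

/-- A `2`-graph: a countable (small) category with a degree functor to `ℕ²` that has the
factorisation property. A morphism `l : x ⟶ y` has source `x` and range `y`, so that the product
`μν` (defined when `s(μ) = r(ν)`) is `ν ≫ μ`. -/
structure TwoGraph where
  Obj : Type u
  [cat : SmallCategory Obj]
  countable : Countable (Σ x y : Obj, (x ⟶ y))
  /-- the degree functor -/
  deg : ∀ {x y : Obj}, (x ⟶ y) → ℕ × ℕ
  deg_id : ∀ x : Obj, deg (𝟙 x) = 0
  deg_comp : ∀ {x y z : Obj} (ν : x ⟶ y) (μ : y ⟶ z), deg (ν ≫ μ) = deg μ + deg ν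
  /-- if `d(l) = m + n` then `l = μν` for unique `μ`, `ν` with `d(μ) = m` and `d(ν) = n` -/
  factorisation : ∀ {x y : Obj} (l : x ⟶ y) (m n : ℕ × ℕ), deg l = m + n →
    ∃! t : (Σ z : Obj, (x ⟶ z) × (z ⟶ y)),
      deg t.2.2 = m ∧ deg t.2.1 = n ∧ t.2.1 ≫ t.2.2 = l

attribute [instance] TwoGraph.cat

namespace TwoGraph

/-- The set `Λ^m` of morphisms of degree `m`. -/
structure Mor (Λ : TwoGraph.{u}) (m : ℕ × ℕ) : Type u where
  /-- source -/
  s : Λ.Obj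
  /-- range -/
  r : Λ.Obj
  hom : s ⟶ r
  deg_hom : Λ.deg hom = m

/-- The degree `e₁`. -/
abbrev e₁ : ℕ × ℕ := (1, 0)

/-- The degree `e₂`. -/
abbrev e₂ : ℕ × ℕ := (0, 1)

variable (Λ : TwoGraph.{u})

/-- The factors of `l = μν` with `d(μ) = m` and `d(ν) = n`: the first component of the pair in the
result is `ν` and the second one is `μ`. -/
noncomputable def factor {x y : Λ.Obj} (l : x ⟶ y) (m n : ℕ × ℕ) (h : Λ.deg l = m + n) :
    Σ z : Λ.Obj, (x ⟶ z) × (z ⟶ y) :=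
  (Λ.factorisation l m n h).choose

theorem factor_spec {x y : Λ.Obj} (l : x ⟶ y) (m n : ℕ × ℕ) (h : Λ.deg l = m + n) :
    Λ.deg (Λ.factor l m n h).2.2 = m ∧ Λ.deg (Λ.factor l m n h).2.1 = n ∧
      (Λ.factor l m n h).2.1 ≫ (Λ.factor l m n h).2.2 = l :=
  (Λ.factorisation l m n h).choose_spec.1

variable {Λ}

theorem Mor.deg12 (l : Λ.Mor (e₁ + e₂)) : Λ.deg l.hom = e₁ + e₂ := l.deg_hom

theorem Mor.deg21 (l : Λ.Mor (e₁ + e₂)) : Λ.deg l.hom = e₂ + e₁ := by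
  rw [l.deg_hom, add_comm]

/-- For `l = f₁g₁ = g₂f₂` of degree `e₁ + e₂` with `d(f_i) = e₁` and `d(g_i) = e₂`, this is
`f₁ = l(0, e₁)`. -/
noncomputable def Mor.f₁ (l : Λ.Mor (e₁ + e₂)) : Λ.Mor e₁ :=
  ⟨_, _, (Λ.factor l.hom e₁ e₂ l.deg12).2.2, (Λ.factor_spec l.hom e₁ e₂ l.deg12).1⟩

/-- The factor `g₁ = l(e₁, e₁ + e₂)` of `l = f₁g₁ = g₂f₂`. -/
noncomputable def Mor.g₁ (l : Λ.Mor (e₁ + e₂)) : Λ.Mor e₂ :=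
  ⟨_, _, (Λ.factor l.hom e₁ e₂ l.deg12).2.1, (Λ.factor_spec l.hom e₁ e₂ l.deg12).2.1⟩

/-- The factor `g₂ = l(0, e₂)` of `l = f₁g₁ = g₂f₂`. -/
noncomputable def Mor.g₂ (l : Λ.Mor (e₁ + e₂)) : Λ.Mor e₂ :=
  ⟨_, _, (Λ.factor l.hom e₂ e₁ l.deg21).2.2, (Λ.factor_spec l.hom e₂ e₁ l.deg21).1⟩

/-- The factor `f₂ = l(e₂, e₁ + e₂)` of `l = f₁g₁ = g₂f₂`. -/
noncomputable def Mor.f₂ (l : Λ.Mor (e₁ + e₂)) : Λ.Mor e₁ :=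
  ⟨_, _, (Λ.factor l.hom e₂ e₁ l.deg21).2.1, (Λ.factor_spec l.hom e₂ e₁ l.deg21).2.1⟩

variable (Λ)

/-- The `1`-skeleton of `Λ`: the `2`-coloured graph with vertices the objects of `Λ` and edges
`Λ^{e₁} ∪ Λ^{e₂}` (a disjoint union), an edge of degree `e_i` having colour `c_i`. -/
def skeleton : ColGraph.{u} where
  V := Λ.Obj
  E := Λ.Mor e₁ ⊕ Λ.Mor e₂
  r := Sum.elim Mor.r Mor.r
  s := Sum.elim Mor.s Mor.s
  colour := Sum.elim (fun _ => .c1) (fun _ => .c2)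

/-- The canonical square `φ_l` of a morphism `l` of degree `e₁ + e₂`:
`φ_l(ε_i^n) = l(n, n + e_i)`. -/
noncomputable def square (l : Λ.Mor (e₁ + e₂)) : Square Λ.skeleton where
  onV
    | .zero => l.r
    | .e1 => l.g₁.r
    | .e2 => l.f₂.r
    | .e12 => l.s
  onE
    | .eps1_0 => Sum.inl l.f₁
    | .eps1_e2 => Sum.inl l.f₂
    | .eps2_0 => Sum.inr l.g₂
    | .eps2_e1 => Sum.inr l.g₁
  r_onE ε := by cases ε <;> rfl
  s_onE ε := by cases ε <;> rfl
  colour_onE ε := by cases ε <;> rfl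

/-- The canonical collection of squares `C_Λ`. -/
def squares : Set (Square Λ.skeleton) := Set.range Λ.square

end TwoGraph

/-- `Λ` is the `2`-graph associated with `T` (written `Λ_T`; it is determined up to isomorphism by
this property): its `1`-skeleton with the canonical squares is square-isomorphic to
`(G_T, C_T)`. -/
def TextileSystem.IsAssociated (T : TextileSystem.{u}) (Λ : TwoGraph.{u}) : Prop :=
  SquareIsomorphic Λ.skeleton Λ.squares T.graph T.squares

/-! ### Chain groups and boundary maps -/

/-- `∂₁ : ℤE¹ → ℤE⁰`, `∂₁(e) = s(e) - r(e)`, for a directed graph. -/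
def DirGraph.bd (E : DirGraph.{u}) : FreeAbelianGroup E.E →+ FreeAbelianGroup E.V :=
  FreeAbelianGroup.lift fun e => FreeAbelianGroup.of (E.s e) - FreeAbelianGroup.of (E.r e)

namespace TextileSystem

variable (T : TextileSystem.{u})

/-- `∂₁ : C₁(T) = ℤE¹ ⊕ ℤF⁰ → C₀(T) = ℤE⁰`, `∂₁(e ⊕ v) = ∂₁^E(e) + (p⁰ - q⁰)(v)`. -/
def bd₁ : FreeAbelianGroup T.E.E × FreeAbelianGroup T.F.V →+ FreeAbelianGroup T.E.V :=
  T.E.bd.coprod (FreeAbelianGroup.map T.p.onV - FreeAbelianGroup.map T.q.onV)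

/-- `∂₂ : C₂(T) = ℤF¹ → C₁(T) = ℤE¹ ⊕ ℤF⁰`, `∂₂(f) = (q¹ - p¹)(f) ⊕ ∂₁^F(f)`. -/
def bd₂ : FreeAbelianGroup T.F.E →+ FreeAbelianGroup T.E.E × FreeAbelianGroup T.F.V :=
  (FreeAbelianGroup.map T.q.onE - FreeAbelianGroup.map T.p.onE).prod T.F.bd

theorem bd₁_bd₂ : T.bd₁.comp T.bd₂ = 0 := by
  ext f
  simp [bd₁, bd₂, DirGraph.bd, T.p.r_onE, T.p.s_onE, T.q.r_onE, T.q.s_onE]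

end TextileSystem

namespace TwoGraph

variable (Λ : TwoGraph.{u})

/-- `∂₁ : C₁(Λ) = ℤΛ^{e₁} ⊕ ℤΛ^{e₂} → C₀(Λ) = ℤΛ⁰`, `∂₁(l) = s(l) - r(l)`. -/
def bd₁ : FreeAbelianGroup (Λ.Mor e₁) × FreeAbelianGroup (Λ.Mor e₂) →+ FreeAbelianGroup Λ.Obj :=
  (FreeAbelianGroup.lift fun l : Λ.Mor e₁ =>
      FreeAbelianGroup.of l.s - FreeAbelianGroup.of l.r).coprod
    (FreeAbelianGroup.lift fun l : Λ.Mor e₂ =>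
      FreeAbelianGroup.of l.s - FreeAbelianGroup.of l.r)

/-- `∂₂ : C₂(Λ) = ℤΛ^{e₁ + e₂} → C₁(Λ) = ℤΛ^{e₁} ⊕ ℤΛ^{e₂}`, `∂₂(l) = f₁ + g₁ - f₂ - g₂` for
`l = f₁g₁ = g₂f₂` with `d(f_i) = e₁` and `d(g_i) = e₂`. -/
noncomputable def bd₂ : FreeAbelianGroup (Λ.Mor (e₁ + e₂)) →+
    FreeAbelianGroup (Λ.Mor e₁) × FreeAbelianGroup (Λ.Mor e₂) :=
  FreeAbelianGroup.lift fun l =>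
    (FreeAbelianGroup.of l.f₁ - FreeAbelianGroup.of l.f₂,
      FreeAbelianGroup.of l.g₁ - FreeAbelianGroup.of l.g₂)

theorem bd₁_bd₂ : Λ.bd₁.comp Λ.bd₂ = 0 := by
  ext l
  simp only [bd₁, bd₂, AddMonoidHom.comp_apply, FreeAbelianGroup.lift_apply_of,
    AddMonoidHom.coprod_apply, map_sub, AddMonoidHom.zero_apply, Mor.f₁, Mor.f₂, Mor.g₁, Mor.g₂]
  abel

end TwoGraph

/-! ### Cochain complexes and cohomology -/

/-- The cochain complex `0 → X₀ → X₁ → X₂ → 0 → ⋯` of abelian groups, `X_i` in degree `i`. -/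
noncomputable def threeTerm (X₀ X₁ X₂ : Type w) [AddCommGroup X₀] [AddCommGroup X₁]
    [AddCommGroup X₂] (d₀ : X₀ →+ X₁) (d₁ : X₁ →+ X₂) (h : d₁.comp d₀ = 0) :
    CochainComplex AddCommGrpCat.{w} ℕ :=
  CochainComplex.of
    (fun
      | 0 => AddCommGrpCat.of X₀
      | 1 => AddCommGrpCat.of X₁
      | 2 => AddCommGrpCat.of X₂
      | _ + 3 => AddCommGrpCat.of PUnit)
    (fun
      | 0 => AddCommGrpCat.ofHom d₀
      | 1 => AddCommGrpCat.ofHom d₁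
      | _ + 2 => 0)
    (fun
      | 0 => by
        change AddCommGrpCat.ofHom d₀ ≫ AddCommGrpCat.ofHom d₁ = 0
        rw [← AddCommGrpCat.ofHom_comp, h]
        rfl
      | 1 => Limits.comp_zero
      | _ + 2 => Limits.zero_comp)

section Cochain

variable (A : Type w) [AddCommGroup A]

/-- `δ⁰ : C⁰(T, A) = Hom(ℤE⁰, A) → C¹(T, A) = Hom(ℤE¹, A) ⊕ Hom(ℤF⁰, A)`,
`(δ⁰b)(e ⊕ v) = b(∂₁(e ⊕ v))`. -/
def TextileSystem.coboundary₀ (T : TextileSystem.{u}) : (FreeAbelianGroup T.E.V →+ A) →+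
    (FreeAbelianGroup T.E.E →+ A) × (FreeAbelianGroup T.F.V →+ A) where
  toFun b := ((b.comp T.bd₁).comp (AddMonoidHom.inl _ _),
    (b.comp T.bd₁).comp (AddMonoidHom.inr _ _))
  map_zero' := rfl
  map_add' _ _ := rfl

/-- `δ¹ : C¹(T, A) = Hom(ℤE¹, A) ⊕ Hom(ℤF⁰, A) → C²(T, A) = Hom(ℤF¹, A)`,
`(δ¹b)(f) = b(∂₂(f))`. -/
def TextileSystem.coboundary₁ (T : TextileSystem.{u}) :
    (FreeAbelianGroup T.E.E →+ A) × (FreeAbelianGroup T.F.V →+ A) →+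
      (FreeAbelianGroup T.F.E →+ A) where
  toFun b := (b.1.coprod b.2).comp T.bd₂
  map_zero' := by ext; simp
  map_add' _ _ := by ext; simp; abel

theorem TextileSystem.coboundary_comp (T : TextileSystem.{u}) :
    (T.coboundary₁ A).comp (T.coboundary₀ A) = 0 := by
  refine AddMonoidHom.ext fun b => ?_
  have h : ((b.comp T.bd₁).comp (AddMonoidHom.inl _ _)).coprod
      ((b.comp T.bd₁).comp (AddMonoidHom.inr _ _)) = b.comp T.bd₁ :=
    AddMonoidHom.coprod_unique _
  change (AddMonoidHom.coprod ((b.comp T.bd₁).comp (AddMonoidHom.inl _ _))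
    ((b.comp T.bd₁).comp (AddMonoidHom.inr _ _))).comp T.bd₂ = 0
  rw [h, AddMonoidHom.comp_assoc, T.bd₁_bd₂, AddMonoidHom.comp_zero]

/-- The cochain complex `(C^*(T, A), δ_T^*)` of a textile system. -/
noncomputable def TextileSystem.cochainComplex (T : TextileSystem.{u}) :
    CochainComplex AddCommGrpCat.{max u w} ℕ :=
  threeTerm _ _ _ (T.coboundary₀ A) (T.coboundary₁ A) (T.coboundary_comp A)

/-- The cohomology group `H^n(T, A)` of a textile system. -/
noncomputable def TextileSystem.cohomology (T : TextileSystem.{u}) (n : ℕ) :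
    AddCommGrpCat.{max u w} :=
  (T.cochainComplex A).homology n

/-- `δ⁰ : C⁰(Λ, A) → C¹(Λ, A)`, `δ⁰b = b ∘ ∂₁`, where `C^i(Λ, A) = Hom(C_i(Λ), A)`. -/
def TwoGraph.coboundary₀ (Λ : TwoGraph.{u}) : (FreeAbelianGroup Λ.Obj →+ A) →+
    (FreeAbelianGroup (Λ.Mor TwoGraph.e₁) × FreeAbelianGroup (Λ.Mor TwoGraph.e₂) →+ A) :=
  AddMonoidHom.compHom.flip Λ.bd₁

/-- `δ¹ : C¹(Λ, A) → C²(Λ, A)`, `δ¹b = b ∘ ∂₂`. -/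
noncomputable def TwoGraph.coboundary₁ (Λ : TwoGraph.{u}) :
    (FreeAbelianGroup (Λ.Mor TwoGraph.e₁) × FreeAbelianGroup (Λ.Mor TwoGraph.e₂) →+ A) →+
      (FreeAbelianGroup (Λ.Mor (TwoGraph.e₁ + TwoGraph.e₂)) →+ A) :=
  AddMonoidHom.compHom.flip Λ.bd₂

theorem TwoGraph.coboundary_comp (Λ : TwoGraph.{u}) :
    (Λ.coboundary₁ A).comp (Λ.coboundary₀ A) = 0 := by
  refine AddMonoidHom.ext fun b => ?_
  change (b.comp Λ.bd₁).comp Λ.bd₂ = 0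
  rw [AddMonoidHom.comp_assoc, Λ.bd₁_bd₂, AddMonoidHom.comp_zero]

/-- The cochain complex `(C^*(Λ, A), δ_Λ^*)` of a `2`-graph. -/
noncomputable def TwoGraph.cochainComplex (Λ : TwoGraph.{u}) :
    CochainComplex AddCommGrpCat.{max u w} ℕ :=
  threeTerm _ _ _ (Λ.coboundary₀ A) (Λ.coboundary₁ A) (Λ.coboundary_comp A)

/-- The cohomology group `H^n(Λ, A)` of a `2`-graph. -/
noncomputable def TwoGraph.cohomology (Λ : TwoGraph.{u}) (n : ℕ) :
    AddCommGrpCat.{max u w} :=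
  (Λ.cochainComplex A).homology n

end Cochain

end Textile

/-! Words are read from range to source. The two lifting conditions say that `f ↦ (r(f), p(f))` is a
bijection from `F¹` to the composable pairs `we` and `f ↦ (q(f), s(f))` one to the composable pairs
`ew`. So the squares amount to a bijection `σ` from two-letter paths of colours `c₂c₁` to those of
colours `c₁c₂` (`TextileSystem.isSwap`).

Existence: `σ` rewrites every path into a normal form, a `c₁`-word followed by a `c₂`-word. Normal
forms compose by pushing the inner `c₂`-word past the inner `c₁`-word, which fills a rectangle with
squares. Pasting rectangles gives associativity; with two colours there are no cubes, so no further
condition arises. Pushing is bijective on composable words (`pushWord_inj`, `pushWord_surj`), and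
this is the factorisation property (`existsUnique_factor`).

Comparison: for any associated `Λ`, the skeleton isomorphism and the squares send each `l = f₁g₁ =
g₂f₂` to an edge `f` of `F` with `q(f), p(f), s(f), r(f)` corresponding to `f₁, f₂, g₁, g₂`. This is
a bijection (`IsAssociated.exists_equivs`), and under it the coboundary formulas agree on
generators. -/

namespace Textile

/-! ### Paths as lists of edges -/

/-- `IsPath r s y l x`: the list `l` of edges is a path with range `y` and source `x`, in the graph
with range map `r` and source map `s`. -/
def IsPath {V X : Type*} (r s : X → V) : V → List X → V → Prop
  | y, [], x => y = x
  | y, e :: l, x => r e = y ∧ IsPath r s (s e) l x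

section Paths

variable {V X : Type*} {r s : X → V}

@[simp]
theorem isPath_nil {y x : V} : IsPath r s y [] x ↔ y = x := Iff.rfl

@[simp]
theorem isPath_cons {y x : V} {e : X} {l : List X} :
    IsPath r s y (e :: l) x ↔ r e = y ∧ IsPath r s (s e) l x := Iff.rfl

theorem isPath_append {y x : V} {l l' : List X} :
    IsPath r s y (l ++ l') x ↔ ∃ z, IsPath r s y l z ∧ IsPath r s z l' x := by
  induction l generalizing y with
  | nil => simp
  | cons e l ih => simp [ih, and_assoc]

theorem IsPath.source_unique {y x x' : V} {l : List X} (h : IsPath r s y l x)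
    (h' : IsPath r s y l x') : x = x' := by
  induction l generalizing y with
  | nil => exact h.symm.trans h'
  | cons e l ih => exact ih h.2 h'.2

end Paths

/-! ### Moving a path of one colour past a path of the other colour -/

section Swap

variable {X W : Type*} (σ : W → X → X × W)

/-- Move one letter `w` past a word, one letter after the other. -/
def pushLetter : W → List X → List X × W
  | w, [] => ([], w)
  | w, e :: l => ((σ w e).1 :: (pushLetter (σ w e).2 l).1, (pushLetter (σ w e).2 l).2)

/-- Move a word past a word. -/
def pushWord : List W → List X → List X × List W
  | [], l => (l, [])
  | w :: m, l => ((pushLetter σ w (pushWord m l).1).1,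
      (pushLetter σ w (pushWord m l).1).2 :: (pushWord m l).2)

theorem pushLetter_append (w : W) (l l' : List X) :
    pushLetter σ w (l ++ l') =
      ((pushLetter σ w l).1 ++ (pushLetter σ (pushLetter σ w l).2 l').1,
        (pushLetter σ (pushLetter σ w l).2 l').2) := by
  induction l generalizing w with
  | nil => rfl
  | cons e l ih => simp [pushLetter, ih]

theorem pushWord_nil_right (m : List W) : pushWord σ m [] = ([], m) := by
  induction m with
  | nil => rfl
  | cons w m ih => simp [pushWord, ih, pushLetter]

/-- A rectangle of squares may be cut in two parallel to either side and filled piece by piece. This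
lemma and `pushWord_append_right` are the two cuts; together they give associativity of composition.
-/
theorem pushWord_append_left (m m' : List W) (l : List X) :
    pushWord σ (m ++ m') l =
      ((pushWord σ m (pushWord σ m' l).1).1,
        (pushWord σ m (pushWord σ m' l).1).2 ++ (pushWord σ m' l).2) := by
  induction m with
  | nil => rfl
  | cons w m ih => simp [pushWord, ih]

theorem pushWord_append_right (m : List W) (l l' : List X) :
    pushWord σ m (l ++ l') =
      ((pushWord σ m l).1 ++ (pushWord σ (pushWord σ m l).2 l').1,
        (pushWord σ (pushWord σ m l).2 l').2) := by
  induction m with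
  | nil => rfl
  | cons w m ih => simp [pushWord, ih, pushLetter_append]

theorem length_pushLetter (w : W) (l : List X) : (pushLetter σ w l).1.length = l.length := by
  induction l generalizing w with
  | nil => rfl
  | cons e l ih => simp [pushLetter, ih]

theorem length_pushWord_fst (m : List W) (l : List X) :
    (pushWord σ m l).1.length = l.length := by
  induction m with
  | nil => rfl
  | cons w m ih => simp [pushWord, length_pushLetter, ih]

theorem length_pushWord_snd (m : List W) (l : List X) :
    (pushWord σ m l).2.length = m.length := by
  induction m with
  | nil => rfl
  | cons w m ih => simp [pushWord, ih]

end Swap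

/-- A rule that replaces each composable pair `(w, e)` of edges by a composable pair `(e', w')` with
the same range and source, bijectively. -/
structure IsSwap {V X W : Type*} (r s : X → V) (r' s' : W → V) (σ : W → X → X × W) : Prop where
  spec : ∀ w e, s' w = r e →
    r (σ w e).1 = r' w ∧ s (σ w e).1 = r' (σ w e).2 ∧ s' (σ w e).2 = s e
  inj : ∀ w e v f, s' w = r e → s' v = r f → σ w e = σ v f → w = v ∧ e = f
  surj : ∀ e w, s e = r' w → ∃ v f, s' v = r f ∧ σ v f = (e, w)

namespace IsSwap

variable {V X W : Type*} {r s : X → V} {r' s' : W → V} {σ : W → X → X × W}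

theorem pushLetter_spec (h : IsSwap r s r' s' σ) {w : W} {l : List X} {x : V}
    (hl : IsPath r s (s' w) l x) :
    IsPath r s (r' w) (pushLetter σ w l).1 (r' (pushLetter σ w l).2) ∧
      s' (pushLetter σ w l).2 = x := by
  induction l generalizing w with
  | nil => exact ⟨rfl, hl⟩
  | cons e l ih =>
    obtain ⟨h1, h2, h3⟩ := h.spec w e hl.1.symm
    have := ih (w := (σ w e).2) (h3 ▸ hl.2)
    exact ⟨⟨h1, h2 ▸ this.1⟩, this.2⟩

theorem pushWord_spec (h : IsSwap r s r' s' σ) {m : List W} {l : List X} {y z x : V}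
    (hm : IsPath r' s' y m z) (hl : IsPath r s z l x) :
    ∃ t, IsPath r s y (pushWord σ m l).1 t ∧ IsPath r' s' t (pushWord σ m l).2 x := by
  induction m generalizing y with
  | nil => obtain rfl : y = z := hm; exact ⟨x, hl, rfl⟩
  | cons w m ih =>
    obtain ⟨t, h1, h2⟩ := ih hm.2
    obtain ⟨h3, h4⟩ := h.pushLetter_spec h1
    exact ⟨_, hm.1 ▸ h3, rfl, h4 ▸ h2⟩

/-- The strip of squares is undone from its far end: the tails determine the letter that leaves the
first square, and then `σ` is inverted on that square. -/
theorem pushLetter_inj (h : IsSwap r s r' s' σ) {w v : W} {l k : List X} {x x' : V}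
    (hl : IsPath r s (s' w) l x) (hk : IsPath r s (s' v) k x')
    (e : pushLetter σ w l = pushLetter σ v k) : w = v ∧ l = k := by
  induction l generalizing w v k with
  | nil =>
    cases k with
    | nil => simpa [pushLetter] using e
    | cons f k => simp [pushLetter] at e
  | cons a l ih =>
    cases k with
    | nil => simp [pushLetter] at e
    | cons f k =>
      simp only [pushLetter, Prod.mk.injEq, List.cons.injEq] at e
      obtain ⟨⟨e1, e2⟩, e3⟩ := e
      obtain ⟨h1, rfl⟩ := ih ((h.spec w a hl.1.symm).2.2 ▸ hl.2)
        ((h.spec v f hk.1.symm).2.2 ▸ hk.2) (Prod.ext e2 e3)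
      obtain ⟨rfl, rfl⟩ := h.inj w a v f hl.1.symm hk.1.symm (Prod.ext e1 h1)
      exact ⟨rfl, rfl⟩

/-- The first letter of the word is pushed last, so its strip is the first to be undone. What
remains is the same problem for the shorter word. -/
theorem pushWord_inj (h : IsSwap r s r' s' σ) {m n : List W} {l k : List X} {y y' z z' x x' : V}
    (hm : IsPath r' s' y m z) (hl : IsPath r s z l x) (hn : IsPath r' s' y' n z')
    (hk : IsPath r s z' k x') (e : pushWord σ m l = pushWord σ n k) : m = n ∧ l = k := by
  induction m generalizing y y' n with
  | nil =>
    cases n with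
    | nil => simpa [pushWord] using e
    | cons v n => simp [pushWord] at e
  | cons w m ih =>
    cases n with
    | nil => simp [pushWord] at e
    | cons v n =>
      simp only [pushWord, Prod.mk.injEq, List.cons.injEq] at e
      obtain ⟨e1, e2, e3⟩ := e
      obtain ⟨t, h1, -⟩ := h.pushWord_spec hm.2 hl
      obtain ⟨t', h2, -⟩ := h.pushWord_spec hn.2 hk
      obtain ⟨rfl, h3⟩ := h.pushLetter_inj h1 h2 (Prod.ext e1 e2)
      obtain ⟨rfl, rfl⟩ := ih hm.2 hn.2 (Prod.ext h3 e3)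
      exact ⟨rfl, rfl⟩

/-- Squares are rebuilt backwards from the end of `l`, each one handing its `c₂`-letter to the
square before it. -/
theorem pushLetter_surj (h : IsSwap r s r' s' σ) {y : V} {l : List X} {w : W}
    (hl : IsPath r s y l (r' w)) :
    ∃ v k, r' v = y ∧ IsPath r s (s' v) k (s' w) ∧ pushLetter σ v k = (l, w) := by
  induction l generalizing y with
  | nil => exact ⟨w, [], hl.symm, rfl, rfl⟩
  | cons e l ih =>
    obtain ⟨v, k, h1, h2, h3⟩ := ih hl.2
    obtain ⟨u, f, h4, h5⟩ := h.surj e v h1.symm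
    have h6 := h.spec u f h4
    rw [h5] at h6
    exact ⟨u, f :: k, h6.1.symm.trans hl.1, ⟨h4.symm, h6.2.2 ▸ h2⟩, by simp [pushLetter, h5, h3]⟩

theorem pushWord_surj (h : IsSwap r s r' s' σ) {y z x : V} {l : List X} {m : List W}
    (hl : IsPath r s y l z) (hm : IsPath r' s' z m x) :
    ∃ t n k, IsPath r' s' y n t ∧ IsPath r s t k x ∧ pushWord σ n k = (l, m) := by
  induction m generalizing y z l with
  | nil => obtain rfl : z = x := hm; exact ⟨y, [], l, rfl, hl, rfl⟩
  | cons w m ih =>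
    obtain ⟨rfl, hm⟩ := hm
    obtain ⟨v, k, h1, h2, h3⟩ := h.pushLetter_surj hl
    obtain ⟨t, n, k', h4, h5, h6⟩ := ih h2 hm
    exact ⟨t, v :: n, k', ⟨h1, h4⟩, h5, by simp [pushWord, h6, h3]⟩

end IsSwap

/-! ### The `2`-graph of a swap -/

/-- A morphism from `x` to `y`: a path of the first colour with range `y` followed by a path of the
second colour with source `x`. -/
@[ext]
structure BiPath {V X W : Type u} (r s : X → V) (r' s' : W → V) (x y : V) : Type u where
  fst : List X
  snd : List W
  valid : ∃ z, IsPath r s y fst z ∧ IsPath r' s' z snd x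

namespace IsSwap

variable {V X W : Type u} {r s : X → V} {r' s' : W → V} {σ : W → X → X × W}

/-- The category of bicoloured paths. -/
@[reducible]
def category (h : IsSwap r s r' s' σ) : SmallCategory V where
  Hom := BiPath r s r' s'
  id x := ⟨[], [], x, rfl, rfl⟩
  comp {x y z} ν μ :=
    ⟨μ.fst ++ (pushWord σ μ.snd ν.fst).1, (pushWord σ μ.snd ν.fst).2 ++ ν.snd, by
      obtain ⟨a, h1, h2⟩ := μ.valid
      obtain ⟨b, h3, h4⟩ := ν.valid
      obtain ⟨t, h5, h6⟩ := h.pushWord_spec h2 h3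
      exact ⟨t, isPath_append.2 ⟨a, h1, h5⟩, isPath_append.2 ⟨b, h6, h4⟩⟩⟩
  id_comp f := by ext1 <;> simp [pushWord_nil_right]
  comp_id f := by ext1 <;> simp [pushWord]
  assoc f g k := by
    ext1 <;> simp [pushWord_append_left, pushWord_append_right]

/-- Cut the normal form as `L₁L₂M₁M₂`, with `L₁` and `M₁` of the lengths prescribed by `m`. The
inner part `L₂M₁` is the push of a unique composable `NK`, so the factors must be `L₁N` and `KM₂`.
-/
theorem existsUnique_factor (h : IsSwap r s r' s' σ) {x y : V} (l : BiPath r s r' s' x y)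
    (m n : ℕ × ℕ) (hl : (l.fst.length, l.snd.length) = m + n) :
    ∃! t : (Σ z : V, BiPath r s r' s' x z × BiPath r s r' s' z y),
      (t.2.2.fst.length, t.2.2.snd.length) = m ∧ (t.2.1.fst.length, t.2.1.snd.length) = n ∧
        h.category.comp t.2.1 t.2.2 = l := by
  obtain ⟨m₁, m₂⟩ := m
  obtain ⟨n₁, n₂⟩ := n
  obtain ⟨L, M, z, hL, hM⟩ := l
  simp only [Prod.mk_add_mk, Prod.mk.injEq] at hl
  obtain ⟨hl1, hl2⟩ := hl
  obtain ⟨L₁, L₂, rfl, hL₁⟩ : ∃ L₁ L₂, L = L₁ ++ L₂ ∧ L₁.length = m₁ :=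
    ⟨L.take m₁, L.drop m₁, (List.take_append_drop _ _).symm, by simp; omega⟩
  obtain ⟨M₁, M₂, rfl, hM₁⟩ : ∃ M₁ M₂, M = M₁ ++ M₂ ∧ M₁.length = m₂ :=
    ⟨M.take m₂, M.drop m₂, (List.take_append_drop _ _).symm, by simp; omega⟩
  obtain ⟨a, ha, ha'⟩ := isPath_append.1 hL
  obtain ⟨b, hb, hb'⟩ := isPath_append.1 hM
  obtain ⟨t, N, K, hN, hK, hNK⟩ := h.pushWord_surj ha' hb
  have hK' : K.length = L₂.length := by rw [← length_pushWord_fst σ N K, hNK]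
  have hN' : N.length = M₁.length := by rw [← length_pushWord_snd σ N K, hNK]
  simp only [List.length_append] at hl1 hl2
  refine ⟨⟨t, ⟨K, M₂, b, hK, hb'⟩, ⟨L₁, N, a, ha, hN⟩⟩, ⟨?_, ?_, ?_⟩, ?_⟩
  · simp [hL₁, hN', hM₁]
  · simp only [Prod.mk.injEq]; omega
  · refine BiPath.ext ?_ ?_
    · change L₁ ++ (pushWord σ N K).1 = L₁ ++ L₂
      rw [hNK]
    · change (pushWord σ N K).2 ++ M₂ = M₁ ++ M₂
      rw [hNK]
  · rintro ⟨t', ⟨K', M₂', b', hb1, hb2⟩, ⟨L₁', N', a', ha1, ha2⟩⟩ ⟨d1, d2, d3⟩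
    obtain ⟨d1, d1'⟩ := Prod.mk.inj d1
    obtain ⟨d2, d2'⟩ := Prod.mk.inj d2
    dsimp only at d1 d1' d2 d2'
    have e1 : L₁' ++ (pushWord σ N' K').1 = L₁ ++ L₂ := congrArg BiPath.fst d3
    have e2 : (pushWord σ N' K').2 ++ M₂' = M₁ ++ M₂ := congrArg BiPath.snd d3
    -- Pushing preserves lengths, so the degrees force both factorisations to cut the words at the
    -- same places.
    obtain ⟨rfl, e3⟩ := List.append_inj e1 (by omega)
    obtain ⟨e4, rfl⟩ := List.append_inj e2 (by rw [length_pushWord_snd]; omega)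
    obtain ⟨rfl, rfl⟩ := h.pushWord_inj ha2 hb1 hN hK (by rw [hNK, ← e3, ← e4])
    -- The middle object is determined too: it is the source of the path `L₁` followed by `N` with
    -- range `y`.
    obtain rfl := ha.source_unique ha1
    obtain rfl := ha2.source_unique hN
    rfl

/-- The `2`-graph of bicoloured paths. -/
def twoGraph (h : IsSwap r s r' s' σ) [Countable V] [Countable X] [Countable W] :
    TwoGraph.{u} where
  Obj := V
  cat := h.category
  countable := by
    let F : (Σ x y : V, BiPath r s r' s' x y) → V × V × List X × List W :=
      fun t => (t.1, t.2.1, t.2.2.fst, t.2.2.snd)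
    refine Function.Injective.countable (f := F) ?_
    rintro ⟨x, y, f, g, h⟩ ⟨x', y', f', g', h'⟩ e
    simp only [F, Prod.mk.injEq] at e
    obtain ⟨rfl, rfl, rfl, rfl⟩ := e
    rfl
  deg f := (f.fst.length, f.snd.length)
  deg_id _ := rfl
  deg_comp ν μ := by
    simp [CategoryStruct.comp, length_pushWord_fst, length_pushWord_snd, add_comm]
  factorisation l m n hl := h.existsUnique_factor l m n hl

end IsSwap

/-! ### The `2`-graph of a textile system -/

namespace TextileSystem

variable {T : TextileSystem.{u}}

open Classical in
/-- The swap `(r(f), p(f)) ↦ (q(f), s(f))` of a textile system. Pairs that are not composable are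
merely reversed. -/
noncomputable def swap (T : TextileSystem.{u}) (w : T.F.V) (e : T.E.E) : T.E.E × T.F.V :=
  if h : ∃ f, T.F.r f = w ∧ T.p.onE f = e then (T.q.onE h.choose, T.F.s h.choose) else (e, w)

theorem exists_swap_eq (hp : T.p.UniqueRLifting) {w : T.F.V} {e : T.E.E}
    (h : T.p.onV w = T.E.r e) : ∃ f, T.F.r f = w ∧ T.p.onE f = e ∧
      T.swap w e = (T.q.onE f, T.F.s f) := by
  have hf := (hp e w h.symm).exists
  exact ⟨hf.choose, hf.choose_spec.1, hf.choose_spec.2, by rw [swap, dif_pos hf]⟩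

/-- Lifting for `p` makes the rule well defined on composable pairs; lifting for `q` makes it
bijective, uniqueness giving `inj` and existence giving `surj`. -/
theorem isSwap (hp : T.p.UniqueRLifting) (hq : T.q.UniqueSLifting) :
    IsSwap T.E.r T.E.s T.q.onV T.p.onV T.swap where
  spec w e h := by
    obtain ⟨f, rfl, rfl, hf⟩ := exists_swap_eq hp h
    simp [hf, T.q.r_onE, T.q.s_onE, T.p.s_onE]
  inj w e v f hw hv hs := by
    obtain ⟨a, rfl, rfl, ha⟩ := exists_swap_eq hp hw
    obtain ⟨b, rfl, rfl, hb⟩ := exists_swap_eq hp hv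
    rw [ha, hb, Prod.mk.injEq] at hs
    obtain rfl := (hq (T.q.onE a) (T.F.s a) (T.q.s_onE a)).unique ⟨rfl, rfl⟩ ⟨hs.2.symm, hs.1.symm⟩
    exact ⟨rfl, rfl⟩
  surj e w h := by
    obtain ⟨f, rfl, rfl⟩ := (hq e w h).exists
    have h' : T.p.onV (T.F.r f) = T.E.r (T.p.onE f) := (T.p.r_onE f).symm
    refine ⟨_, _, h', ?_⟩
    -- The edge `g` selected by `swap` is `f` by uniqueness of `r`-lifting.
    obtain ⟨g, hg, hg', e⟩ := exists_swap_eq hp h'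
    obtain rfl := (hp _ _ h'.symm).unique ⟨rfl, rfl⟩ ⟨hg, hg'⟩
    exact e

theorem exists_isAssociated (hp : T.p.UniqueRLifting) (hq : T.q.UniqueSLifting)
    (hT : T.IsCountable) : ∃ Λ : TwoGraph.{u}, T.IsAssociated Λ := by
  obtain ⟨⟨_, _⟩, _, _⟩ := hT
  have hs := isSwap hp hq
  let Λ : TwoGraph.{u} := hs.twoGraph
  have h1 (l : Λ.Mor TwoGraph.e₁) : ∃ e, l.hom.fst = [e] ∧ l.hom.snd = [] ∧
      T.E.r e = l.r ∧ T.E.s e = l.s := by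
    obtain ⟨x, y, ⟨L, M, z, hL, hM⟩, hd⟩ := l
    obtain ⟨d1, d2⟩ := Prod.mk.inj hd
    obtain ⟨e, rfl⟩ := List.length_eq_one_iff.1 d1
    obtain rfl := List.length_eq_zero_iff.1 d2
    exact ⟨e, rfl, rfl, hL.1, hL.2.trans hM⟩
  have h2 (l : Λ.Mor TwoGraph.e₂) : ∃ w, l.hom.fst = [] ∧ l.hom.snd = [w] ∧
      T.q.onV w = l.r ∧ T.p.onV w = l.s := by
    obtain ⟨x, y, ⟨L, M, z, hL, hM⟩, hd⟩ := l
    obtain ⟨d1, d2⟩ := Prod.mk.inj hd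
    obtain ⟨e, rfl⟩ := List.length_eq_one_iff.1 d2
    obtain rfl := List.length_eq_zero_iff.1 d1
    exact ⟨e, rfl, rfl, hM.1.trans hL.symm, hM.2⟩
  choose E hE1 hE2 hEr hEs using h1
  choose W hW1 hW2 hWr hWs using h2
  -- The product `f₁g₁` is already in normal form, while normalising `g₂f₂` applies `swap` once;
  -- both are `l`.
  have hEW (l : Λ.Mor (TwoGraph.e₁ + TwoGraph.e₂)) :
      T.swap (W l.g₂) (E l.f₂) = (E l.f₁, W l.g₁) := by
    have a1 := (Λ.factor_spec l.hom _ _ l.deg12).2.2.trans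
      (Λ.factor_spec l.hom _ _ l.deg21).2.2.symm
    have a2 : l.f₁.hom.fst ++ (pushWord T.swap l.f₁.hom.snd l.g₁.hom.fst).1 =
        l.g₂.hom.fst ++ (pushWord T.swap l.g₂.hom.snd l.f₂.hom.fst).1 := congrArg BiPath.fst a1
    have a3 : (pushWord T.swap l.f₁.hom.snd l.g₁.hom.fst).2 ++ l.g₁.hom.snd =
        (pushWord T.swap l.g₂.hom.snd l.f₂.hom.fst).2 ++ l.f₂.hom.snd := congrArg BiPath.snd a1
    rw [hE1, hE1, hE2, hW1, hW1, hW2] at a2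
    rw [hE1, hE2, hE2, hW1, hW2, hW2] at a3
    simp only [pushWord, pushLetter, List.append_nil, List.nil_append, List.cons.injEq,
      and_true] at a2 a3
    exact (Prod.ext a2 a3).symm
  let φ : ColHom Λ.skeleton T.graph :=
    { onV := id
      onE := Sum.map E W
      r_onE := by rintro (l | l); exacts [hEr l, hWr l]
      s_onE := by rintro (l | l); exacts [hEs l, hWs l]
      colour_onE := by rintro (l | l) <;> rfl }
  refine ⟨Λ, φ, ⟨Function.bijective_id, Sum.map_bijective.2 ⟨⟨?_, ?_⟩, ?_, ?_⟩⟩, ?_⟩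
  · intro l l' h
    have a1 := (hE1 l).trans ((congrArg (fun e => [e]) h).trans (hE1 l').symm)
    have a2 := (hE2 l).trans (hE2 l').symm
    have a3 := (hEr l).symm.trans ((congrArg _ h).trans (hEr l'))
    have a4 := (hEs l).symm.trans ((congrArg _ h).trans (hEs l'))
    obtain ⟨x, y, f, hd⟩ := l
    obtain ⟨x', y', f', hd'⟩ := l'
    obtain rfl : x = x' := a4
    obtain rfl : y = y' := a3
    obtain rfl : f = f' := BiPath.ext a1 a2
    rfl
  · intro e
    let l : Λ.Mor TwoGraph.e₁ := ⟨T.E.s e, T.E.r e, ⟨[e], [], T.E.s e, ⟨rfl, rfl⟩, rfl⟩, rfl⟩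
    exact ⟨l, (List.cons.inj (hE1 l)).1.symm⟩
  · intro l l' h
    have a1 := (hW2 l).trans ((congrArg (fun e => [e]) h).trans (hW2 l').symm)
    have a2 := (hW1 l).trans (hW1 l').symm
    have a3 := (hWr l).symm.trans ((congrArg _ h).trans (hWr l'))
    have a4 := (hWs l).symm.trans ((congrArg _ h).trans (hWs l'))
    obtain ⟨x, y, f, hd⟩ := l
    obtain ⟨x', y', f', hd'⟩ := l'
    obtain rfl : x = x' := a4
    obtain rfl : y = y' := a3
    obtain rfl : f = f' := BiPath.ext a2 a1
    rfl
  · intro w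
    let l : Λ.Mor TwoGraph.e₂ := ⟨T.p.onV w, T.q.onV w, ⟨[], [w], T.q.onV w, rfl, rfl, rfl⟩, rfl⟩
    exact ⟨l, (List.cons.inj (hW2 l)).1.symm⟩
  · rintro _ ⟨l, rfl⟩
    -- `f` is chosen to fit the side `g₂f₂`; by `hEW` it then fits the side `f₁g₁`.
    obtain ⟨f, hr, hpf, hf⟩ := exists_swap_eq hp
      (show T.p.onV (W l.g₂) = T.E.r (E l.f₂) from (hWs l.g₂).trans (hEr l.f₂).symm)
    rw [hEW, Prod.mk.injEq] at hf
    refine ⟨f, ?_⟩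
    ext ε
    · cases ε
      · exact (congrArg T.q.onV hr).trans (hWr l.g₂)
      · exact (congrArg T.q.onV hf.2.symm).trans (hWr l.g₁)
      · exact (congrArg T.p.onV hr).trans (hWs l.g₂)
      · exact (congrArg T.p.onV hf.2.symm).trans (hWs l.g₁)
    · cases ε
      · exact congrArg Sum.inl hf.1.symm
      · exact congrArg Sum.inl hpf
      · exact congrArg Sum.inr hr
      · exact congrArg Sum.inr hf.2.symm

end TextileSystem

/-! ### Morphisms of degree `e₁ + e₂` and their factors -/

namespace TwoGraph

variable {Λ : TwoGraph.{u}}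

/-- The composite `ab` of morphisms with `s(a) = r(b)` and of degrees `e₁`, `e₂`. -/
def Mor.mul (a : Λ.Mor e₁) (b : Λ.Mor e₂) (h : b.r = a.s) : Λ.Mor (e₁ + e₂) :=
  ⟨b.s, a.r, b.hom ≫ eqToHom h ≫ a.hom, by
    have key {x y : Λ.Obj} (h : x = y) : Λ.deg (eqToHom h) = 0 := by
      subst h
      exact Λ.deg_id x
    rw [Λ.deg_comp, Λ.deg_comp, a.deg_hom, b.deg_hom, key, add_zero]⟩

theorem Mor.f₁_mul_g₁ (l : Λ.Mor (e₁ + e₂)) : Mor.mul l.f₁ l.g₁ rfl = l := by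
  obtain ⟨x, y, f, hf⟩ := l
  simp only [Mor.mul, Mor.f₁, Mor.g₁]
  congr 1
  exact (congrArg (_ ≫ ·) (Category.id_comp _)).trans (Λ.factor_spec f e₁ e₂ hf).2.2

theorem Mor.eq_of_factors {l l' : Λ.Mor (e₁ + e₂)} (hf : l.f₁ = l'.f₁) (hg : l.g₁ = l'.g₁) :
    l = l' := by
  rw [← l.f₁_mul_g₁, ← l'.f₁_mul_g₁]
  simp only [hf, hg]

theorem Mor.factors_mul (a : Λ.Mor e₁) (b : Λ.Mor e₂) (h : b.r = a.s) :
    (Mor.mul a b h).f₁ = a ∧ (Mor.mul a b h).g₁ = b := by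
  obtain ⟨z, y, f, hf⟩ := a
  obtain ⟨x, z', g, hg⟩ := b
  obtain rfl : z' = z := h
  let l := Mor.mul (⟨z', y, f, hf⟩ : Λ.Mor e₁) ⟨x, z', g, hg⟩ rfl
  have key : Λ.factor l.hom e₁ e₂ l.deg12 = ⟨z', g, f⟩ :=
    (Λ.factorisation l.hom e₁ e₂ l.deg12).unique (Λ.factor_spec l.hom e₁ e₂ l.deg12)
      ⟨hf, hg, (congrArg (g ≫ ·) (Category.id_comp f)).symm⟩
  -- The types of the factors depend on the middle object, so the factorisation is generalised to a
  -- variable `t` before `key` is substituted.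
  have h₁ : ∀ (t : Σ z : Λ.Obj, (x ⟶ z) × (z ⟶ y)) (ht : Λ.deg t.2.2 = e₁), t = ⟨z', g, f⟩ →
      (⟨t.1, y, t.2.2, ht⟩ : Λ.Mor e₁) = ⟨z', y, f, hf⟩ := by
    rintro _ _ rfl
    rfl
  have h₂ : ∀ (t : Σ z : Λ.Obj, (x ⟶ z) × (z ⟶ y)) (ht : Λ.deg t.2.1 = e₂), t = ⟨z', g, f⟩ →
      (⟨x, t.1, t.2.1, ht⟩ : Λ.Mor e₂) = ⟨x, z', g, hg⟩ := by
    rintro _ _ rfl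
    rfl
  exact ⟨h₁ _ _ key, h₂ _ _ key⟩

end TwoGraph

/-! ### Comparison of the cochain complexes -/

/-- Isomorphic three-term complexes. -/
theorem nonempty_threeTerm_iso {X₀ X₁ X₂ Y₀ Y₁ Y₂ : Type w} [AddCommGroup X₀] [AddCommGroup X₁]
    [AddCommGroup X₂] [AddCommGroup Y₀] [AddCommGroup Y₁] [AddCommGroup Y₂]
    {d₀ : X₀ →+ X₁} {d₁ : X₁ →+ X₂} {h : d₁.comp d₀ = 0}
    {d₀' : Y₀ →+ Y₁} {d₁' : Y₁ →+ Y₂} {h' : d₁'.comp d₀' = 0}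
    (i₀ : X₀ ≃+ Y₀) (i₁ : X₁ ≃+ Y₁) (i₂ : X₂ ≃+ Y₂)
    (c₀ : ∀ x, d₀' (i₀ x) = i₁ (d₀ x)) (c₁ : ∀ x, d₁' (i₁ x) = i₂ (d₁ x)) :
    Nonempty (threeTerm X₀ X₁ X₂ d₀ d₁ h ≅ threeTerm Y₀ Y₁ Y₂ d₀' d₁' h') := by
  refine ⟨HomologicalComplex.Hom.isoOfComponents
    (fun
      | 0 => i₀.toAddCommGrpIso
      | 1 => i₁.toAddCommGrpIso
      | 2 => i₂.toAddCommGrpIso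
      | _ + 3 => Iso.refl (AddCommGrpCat.of PUnit)) ?_⟩
  rintro n _ rfl
  have of_d (X : ℕ → AddCommGrpCat.{w}) (d : ∀ n, X n ⟶ X (n + 1)) (sq) (n : ℕ) :
      (CochainComplex.of X d sq).d n (n + 1) = d n := CochainComplex.of_d X d n
  unfold threeTerm
  rw [of_d, of_d]
  match n with
  | 0 => ext x; exact c₀ x
  | 1 => ext x; exact c₁ x
  | _ + 2 => exact Limits.comp_zero.trans Limits.zero_comp.symm

/-- Additive maps on free abelian groups depend only on the basis, up to bijection. -/
def freeHomCongr {X Y : Type u} (e : X ≃ Y) (A : Type w) [AddCommGroup A] :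
    (FreeAbelianGroup X →+ A) ≃+ (FreeAbelianGroup Y →+ A) where
  toFun b := b.comp (FreeAbelianGroup.map e.symm)
  invFun b := b.comp (FreeAbelianGroup.map e)
  left_inv b := by ext; simp
  right_inv b := by ext; simp
  map_add' _ _ := rfl

@[simp]
theorem freeHomCongr_of {X Y : Type u} (e : X ≃ Y) (A : Type w) [AddCommGroup A]
    (b : FreeAbelianGroup X →+ A) (y : Y) :
    freeHomCongr e A b (FreeAbelianGroup.of y) = b (FreeAbelianGroup.of (e.symm y)) := by
  simp [freeHomCongr]

/-- Additive maps out of a product of two groups. -/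
def prodHomEquiv (M N A : Type*) [AddCommGroup M] [AddCommGroup N] [AddCommGroup A] :
    (M × N →+ A) ≃+ (M →+ A) × (N →+ A) where
  toFun b := (b.comp (AddMonoidHom.inl _ _), b.comp (AddMonoidHom.inr _ _))
  invFun b := b.1.coprod b.2
  left_inv b := AddMonoidHom.coprod_unique b
  right_inv b := by ext <;> simp
  map_add' _ _ := rfl

/-- A bijection of disjoint unions that respects the summands consists of two bijections. -/
theorem exists_equivs_of_isLeft_eq {X₁ X₂ Y₁ Y₂ : Type*} {φ : X₁ ⊕ X₂ → Y₁ ⊕ Y₂}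
    (hφ : Function.Bijective φ) (h : ∀ x, (φ x).isLeft = x.isLeft) :
    ∃ (i : X₁ ≃ Y₁) (j : X₂ ≃ Y₂), ∀ x, φ x = Sum.map i j x := by
  have h1 (x : X₁) : ∃ y, φ (.inl x) = .inl y := Sum.isLeft_iff.1 (h (.inl x))
  have h2 (x : X₂) : ∃ y, φ (.inr x) = .inr y := Sum.isRight_iff.1 (by
    rw [← Sum.isLeft_eq_false, h]; rfl)
  choose i hi using h1
  choose j hj using h2
  obtain rfl : φ = Sum.map i j := by
    ext1 x
    cases x
    exacts [hi _, hj _]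
  obtain ⟨bi, bj⟩ := Sum.map_bijective.1 hφ
  exact ⟨.ofBijective i bi, .ofBijective j bj, fun _ => rfl⟩

namespace TextileSystem

variable {T : TextileSystem.{u}} {Λ : TwoGraph.{u}}

/-- The bijections between the bases of the chain groups of `T` and those of `Λ_T`. -/
theorem IsAssociated.exists_equivs (hq : T.q.UniqueSLifting) (h : T.IsAssociated Λ) :
    ∃ (iV : Λ.Obj ≃ T.E.V) (iE : Λ.Mor TwoGraph.e₁ ≃ T.E.E) (iW : Λ.Mor TwoGraph.e₂ ≃ T.F.V)
      (iF : Λ.Mor (TwoGraph.e₁ + TwoGraph.e₂) ≃ T.F.E),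
      (∀ l, T.E.s (iE l) = iV l.s ∧ T.E.r (iE l) = iV l.r) ∧
      (∀ l, T.p.onV (iW l) = iV l.s ∧ T.q.onV (iW l) = iV l.r) ∧
      ∀ l, (T.q.onE (iF l) = iE l.f₁ ∧ T.p.onE (iF l) = iE l.f₂) ∧
        T.F.s (iF l) = iW l.g₁ ∧ T.F.r (iF l) = iW l.g₂ := by
  obtain ⟨φ, ⟨bV, bE⟩, hφ⟩ := h
  -- Preserving colours means preserving the two summands of the edge set.
  obtain ⟨iE, iW, hi⟩ := exists_equivs_of_isLeft_eq (φ := φ.onE) bE (by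
    intro x
    have := φ.colour_onE x
    change Sum.elim _ _ (φ.onE x) = Sum.elim _ _ x at this
    cases hx : φ.onE x <;> cases x <;> simp_all)
  have hE (l) : φ.onE (Sum.inl l) = Sum.inl (iE l) := hi _
  have hW (l) : φ.onE (Sum.inr l) = Sum.inr (iW l) := hi _
  have hEs (l) : T.E.s (iE l) = φ.onV l.s := by
    have := φ.s_onE (Sum.inl l); rw [hE] at this; exact this
  have hEr (l) : T.E.r (iE l) = φ.onV l.r := by
    have := φ.r_onE (Sum.inl l); rw [hE] at this; exact this
  have hWs (l) : T.p.onV (iW l) = φ.onV l.s := by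
    have := φ.s_onE (Sum.inr l); rw [hW] at this; exact this
  have hWr (l) : T.q.onV (iW l) = φ.onV l.r := by
    have := φ.r_onE (Sum.inr l); rw [hW] at this; exact this
  have key (l : Λ.Mor (TwoGraph.e₁ + TwoGraph.e₂)) : ∃ f, (T.q.onE f = iE l.f₁ ∧ T.p.onE f = iE l.f₂) ∧
      T.F.s f = iW l.g₁ ∧ T.F.r f = iW l.g₂ := by
    obtain ⟨f, hf⟩ := hφ _ ⟨l, rfl⟩
    have hf' (ε) : (T.square f).onE ε = φ.onE ((Λ.square l).onE ε) := by rw [hf]; rfl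
    exact ⟨f, ⟨Sum.inl_injective ((hf' .eps1_0).trans (hE _)),
      Sum.inl_injective ((hf' .eps1_e2).trans (hE _))⟩,
      Sum.inr_injective ((hf' .eps2_e1).trans (hW _)),
      Sum.inr_injective ((hf' .eps2_0).trans (hW _))⟩
  choose k hk using key
  -- Being associated only puts the image of `C_Λ` inside `C_T`. Surjectivity comes from lifting:
  -- `q(f)` and `s(f)` correspond to a composable pair in `Λ`, and the edge assigned to its product
  -- shares `q` and `s` with `f`, hence equals `f`.
  have bk : Function.Bijective k := by
    constructor
    · intro l l' e
      exact TwoGraph.Mor.eq_of_factors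
        (iE.injective ((hk l).1.1.symm.trans ((congrArg _ e).trans (hk l').1.1)))
        (iW.injective ((hk l).2.1.symm.trans ((congrArg _ e).trans (hk l').2.1)))
    · intro f
      have hc : (iW.symm (T.F.s f)).r = (iE.symm (T.q.onE f)).s := bV.1 (by
        rw [← hWr, ← hEs, Equiv.apply_symm_apply, Equiv.apply_symm_apply, T.q.s_onE])
      obtain ⟨h1, h2⟩ := TwoGraph.Mor.factors_mul _ _ hc
      obtain ⟨⟨k1, -⟩, k2, -⟩ := hk (TwoGraph.Mor.mul _ _ hc)
      rw [h1, Equiv.apply_symm_apply] at k1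
      rw [h2, Equiv.apply_symm_apply] at k2
      exact ⟨_, (hq _ _ (T.q.s_onE f)).unique ⟨k2, k1⟩ ⟨rfl, rfl⟩⟩
  exact ⟨.ofBijective _ bV, iE, iW, .ofBijective k bk, fun l => ⟨hEs l, hEr l⟩,
    fun l => ⟨hWs l, hWr l⟩, hk⟩

/-- The basis bijections respect all faces, so the squares of maps commute on generators. In degree
1 the identification `prodHomEquiv` intervenes, since `Λ` uses homs out of a product and `T` a
product of homs. -/
theorem IsAssociated.nonempty_cochainComplex_iso (hq : T.q.UniqueSLifting) (h : T.IsAssociated Λ)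
    (A : Type w) [AddCommGroup A] : Nonempty (Λ.cochainComplex A ≅ T.cochainComplex A) := by
  obtain ⟨iV, iE, iW, iF, hE, hW, hF⟩ := h.exists_equivs hq
  refine nonempty_threeTerm_iso (freeHomCongr iV A)
    ((prodHomEquiv _ _ A).trans ((freeHomCongr iE A).prodCongr (freeHomCongr iW A)))
    (freeHomCongr iF A) (fun b => Prod.ext ?_ ?_) (fun b => ?_)
  · ext e
    obtain ⟨l, rfl⟩ := iE.surjective e
    simp [coboundary₀, TwoGraph.coboundary₀, prodHomEquiv, AddEquiv.prodCongr, bd₁,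
      TwoGraph.bd₁, DirGraph.bd, hE]
  · ext w
    obtain ⟨l, rfl⟩ := iW.surjective w
    simp [coboundary₀, TwoGraph.coboundary₀, prodHomEquiv, AddEquiv.prodCongr, bd₁,
      TwoGraph.bd₁, hW]
  · ext f
    obtain ⟨l, rfl⟩ := iF.surjective f
    simp [coboundary₁, TwoGraph.coboundary₁, prodHomEquiv, AddEquiv.prodCongr, bd₂,
      TwoGraph.bd₂, DirGraph.bd, hF]
    -- Values of `b` at pairs `(x, 0)` and `(0, y)` are collected into the value of `b` at a single
    -- pair.
    simp only [← map_sub, ← map_add]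
    simp

end TextileSystem

end Textile

theorem mainTheorem9 (T : Textile.TextileSystem.{u}) (hp : T.p.UniqueRLifting)
    (hq : T.q.UniqueSLifting) (A : Type w) [AddCommGroup A] :
    (T.IsCountable → ∃ Λ : Textile.TwoGraph.{u}, T.IsAssociated Λ) ∧
    ∀ Λ : Textile.TwoGraph.{u}, T.IsAssociated Λ →
      Nonempty (Λ.cochainComplex A ≅ T.cochainComplex A) ∧
      ∀ n : ℕ, Nonempty (Λ.cohomology A n ≅ T.cohomology A n) := by
  refine ⟨Textile.TextileSystem.exists_isAssociated hp hq, fun Λ h => ?_⟩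
  obtain ⟨i⟩ := h.nonempty_cochainComplex_iso hq A
  exact ⟨⟨i⟩, fun n => ⟨(HomologicalComplex.homologyFunctor _ _ n).mapIso i⟩⟩
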